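/- Let $0<\varepsilon,\delta<1$ and let $s\ge 1$ be an integer. A random matrix $A\in\mathbb{R}^{m\times d}$ is called a ScaledJL$(\varepsilon,\delta,s)$-matrix if for every fixed $x\in\mathbb{R}^d$, $$\mathbb{P}_A\left[\|s^{-1/2}Ax\|_2^2\notin\left[(1-\varepsilon)\|x\|_2^2,(1+\varepsilon)\|x\|_2^2\right]\right]<\delta .$$ For $B\in\mathbb{R}^{m\times d}$ let $\lambda_i(B^TB)$ denote the $i$-th largest eigenvalue of $B^TB$, counted with multiplicity. There exist universal constants $C>0$ and $0<c<1$ such that the following holds. Let $A\in\mathbb{R}^{m\times d}$ be a ScaledJL$(\varepsilon,\delta,s)$-matrix with $0<\varepsilon\le 1/4$, $0<\delta<1$, $\delta\le C$, $s\ge1$ an integer, $d\ge m$, and let $t\ge 1$ be the real number for which $t\,\varepsilon^{-2}\ln(1/\delta)=m$ (assumed to be at least $1$). Then there exists a measurable set $S\subseteq\operatorname{supp}(A)$ (the support of the distribution of $A$) such that $\mathbb{P}[A\in S]\ge 1/2$ and every $B\in S$ satisfies $$\lambda_{\lceil cm/t\rceil}(B^TB)\ \ge\ \frac{ds}{3m}.$$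 -/

import Mathlib

open MeasureTheory

/-- Random real matrices are measured by the product (Borel) sigma-algebra on their entries. -/
instance Matrix.instMeasurableSpaceReal {m d : ℕ} :
    MeasurableSpace (Matrix (Fin m) (Fin d) ℝ) :=
  inferInstanceAs (MeasurableSpace (Fin m → Fin d → ℝ))

/-- The random matrix `A`, defined on the probability space `(Ω, P)`, is a
ScaledJL(`ε`, `δ`, `s`)-matrix: for every fixed vector `x`, the squared Euclidean norm of
`s ^ (-1/2) A x` lies outside `[(1 - ε) ‖x‖², (1 + ε) ‖x‖²]` with probability less than `δ`. -/
def IsScaledJL {Ω : Type*} [MeasurableSpace Ω] (P : Measure Ω) {m d : ℕ}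
    (A : Ω → Matrix (Fin m) (Fin d) ℝ) (ε δ : ℝ) (s : ℕ) : Prop :=
  ∀ x : EuclideanSpace ℝ (Fin d),
    P {ω | ‖(√(s : ℝ))⁻¹ • Matrix.toEuclideanLin (A ω) x‖ ^ 2 ∉
      Set.Icc ((1 - ε) * ‖x‖ ^ 2) ((1 + ε) * ‖x‖ ^ 2)} < ENNReal.ofReal δ

theorem isHermitian_gram {m d : ℕ} (B : Matrix (Fin m) (Fin d) ℝ) :
    (B.transpose * B).IsHermitian := by
  simpa using Matrix.isHermitian_conjTranspose_mul_self B

/-- `λ_k(Bᵀ B)`, the `k`-th largest eigenvalue of `Bᵀ B` counted with multiplicity, for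
`1 ≤ k ≤ d` (so `k = 1` gives the largest one); by convention `0` for the other values of `k`.
Mathlib's `eigenvalues₀` lists all `d` eigenvalues in decreasing order, starting at index `0`. -/
noncomputable def gramEigenvalue {m d : ℕ} (B : Matrix (Fin m) (Fin d) ℝ) (k : ℕ) : ℝ :=
  if h : 1 ≤ k ∧ k ≤ d then
    (isHermitian_gram B).eigenvalues₀ ⟨k - 1, by rw [Fintype.card_fin]; omega⟩
  else 0

/-! If `B` has fewer than `k` eigenvalues of `BᵀB` above `τ = ds/(3m)`, a standard Gaussian vector
`x` is distorted with probability at least `2δ`. In the eigenbasis the form is diagonal with weights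
`w i = λ i / s`. Let `I` index the eigenvalues at least `τ`. The rank is at most `m`, so the weights
off `I` sum to at most `d/3`: typically they account for less than half of `‖x‖²`, while the few
coordinates in `I` carry little of `‖x‖²` itself.

Shrinking the coordinates in `I` by `√v`, `v = 1 - 19ε/5`, therefore lowers the form by more than
`2ε‖x‖²` and barely changes the norm, so a typical `x` or its shrinking is distorted
(`scaleOn_mem_distortedSet`). The shrinking changes the Gaussian law by a density of second moment
`(1 - (19ε/5)²)^(-|I|/2) ≤ δ^(-1/2)`, because `|I|ε²` is a small multiple of `log (1/δ)`. Hence the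
distorted set itself has measure of order at least `√δ`, which exceeds `2δ` for small `δ`
(`two_mul_le_gaussianPi_distortedSet`).

The JL property, Fubini and Markov leave probability at least `1/2` for matrices with Gaussian
failure measure below `2δ` (`half_le_measure_slice_lt`); these form `S`. -/

/-! ### Change of measure for rescaled Gaussians -/

/-- The density of `N(0, v)` with respect to `N(0, 1)`. -/
noncomputable def gaussianRatio (v x : ℝ) : ℝ := (√v)⁻¹ * Real.exp ((1 - v⁻¹) * x ^ 2 / 2)

theorem measurable_gaussianRatio (v : ℝ) : Measurable (gaussianRatio v) := by
  unfold gaussianRatio; fun_prop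

theorem gaussianRatio_nonneg (v x : ℝ) : 0 ≤ gaussianRatio v x := by
  unfold gaussianRatio; positivity

open ProbabilityTheory in
theorem gaussianReal_eq_withDensity_ratio {v : NNReal} (hv : v ≠ 0) :
    gaussianReal 0 v =
      (gaussianReal 0 1).withDensity fun x => ENNReal.ofReal (gaussianRatio v x) := by
  have hv' : (0 : ℝ) < v := by positivity
  rw [gaussianReal_of_var_ne_zero 0 hv, gaussianReal_of_var_ne_zero 0 one_ne_zero,
    ← withDensity_mul _ (measurable_gaussianPDF 0 1)
      (measurable_gaussianRatio v).ennreal_ofReal]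
  congr 1
  ext x
  rw [Pi.mul_apply, gaussianPDF, gaussianPDF,
    ← ENNReal.ofReal_mul (gaussianPDFReal_nonneg 0 1 x)]
  congr 1
  simp only [gaussianPDFReal, gaussianRatio]
  rw [mul_mul_mul_comm, ← Real.exp_add, Real.sqrt_mul (by positivity : (0 : ℝ) ≤ 2 * Real.pi),
    mul_inv]
  simp only [NNReal.coe_one, mul_one, sub_zero]
  congr 2
  field_simp
  ring

-- The squared ratio times the standard density is a constant times the density of `N(0, v / (2 -
-- v))`; this is why `v < 2` is needed.
open ProbabilityTheory in
theorem lintegral_gaussianRatio_sq {v : ℝ} (hv : 0 < v) (hv2 : v < 2) :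
    ∫⁻ x, ENNReal.ofReal (gaussianRatio v x) ^ 2 ∂(gaussianReal 0 1) =
      ENNReal.ofReal (√(v * (2 - v)))⁻¹ := by
  have hw : 0 < v / (2 - v) := div_pos hv (by linarith)
  set w : NNReal := ⟨v / (2 - v), hw.le⟩ with hwdef
  have hw0 : w ≠ 0 := by
    intro h
    exact hw.ne' (congrArg NNReal.toReal h)
  have hwv : (w : ℝ) = v / (2 - v) := rfl
  rw [gaussianReal_of_var_ne_zero 0 one_ne_zero,
    lintegral_withDensity_eq_lintegral_mul _ (measurable_gaussianPDF 0 1)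
      ((measurable_gaussianRatio v).ennreal_ofReal.pow_const 2)]
  have key : ∀ x, (gaussianPDF 0 1 * fun x => ENNReal.ofReal (gaussianRatio v x) ^ 2) x =
      ENNReal.ofReal (√(v * (2 - v)))⁻¹ * gaussianPDF 0 w x := by
    intro x
    rw [Pi.mul_apply, gaussianPDF, gaussianPDF, ← ENNReal.ofReal_pow (gaussianRatio_nonneg v x),
      ← ENNReal.ofReal_mul (gaussianPDFReal_nonneg 0 1 x), ← ENNReal.ofReal_mul (by positivity)]
    congr 1
    simp only [gaussianPDFReal, gaussianRatio, hwv]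
    have h2 : 0 < 2 - v := by linarith
    rw [mul_pow, ← Real.exp_nat_mul, mul_mul_mul_comm, ← Real.exp_add, ← mul_assoc]
    congr 1
    · rw [Real.sqrt_mul (by positivity : (0 : ℝ) ≤ 2 * Real.pi),
        Real.sqrt_mul (by positivity : (0 : ℝ) ≤ 2 * Real.pi), Real.sqrt_mul hv.le,
        Real.sqrt_div hv.le]
      have a : √v ≠ 0 := (Real.sqrt_pos.2 hv).ne'
      have b : √(2 - v) ≠ 0 := (Real.sqrt_pos.2 h2).ne'
      simp only [NNReal.coe_one, Real.sqrt_one, mul_one]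
      field_simp
    · congr 1
      simp only [NNReal.coe_one, mul_one, sub_zero]
      push_cast
      field_simp
      ring
  rw [lintegral_congr key, lintegral_const_mul _ (measurable_gaussianPDF 0 w),
    lintegral_gaussianPDF_eq_one 0 hw0, mul_one]

theorem lintegral_pi_prod {ι : Type*} [Fintype ι] {E : ι → Type*} [∀ i, MeasurableSpace (E i)]
    (μ : ∀ i, Measure (E i)) [∀ i, IsProbabilityMeasure (μ i)] {f : ∀ i, E i → ENNReal}
    (hf : ∀ i, Measurable (f i)) :
    ∫⁻ x, ∏ i, f i (x i) ∂(Measure.pi μ) = ∏ i, ∫⁻ x, f i x ∂(μ i) := by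
  have hind := ProbabilityTheory.iIndepFun_pi (μ := μ) (X := f) fun i => (hf i).aemeasurable
  have := ProbabilityTheory.lintegral_prod_eq_prod_lintegral_of_indepFun Finset.univ
    (fun i (x : ∀ i, E i) => f i (x i)) hind fun i => (hf i).comp (measurable_pi_apply i)
  rw [this]
  exact Finset.prod_congr rfl fun i _ =>
    (measurePreserving_eval (μ := μ) i).lintegral_comp (hf i)

theorem MeasureTheory.Measure.pi_withDensity_prod {ι : Type*} [Fintype ι] {E : ι → Type*}
    [∀ i, MeasurableSpace (E i)] (μ ν : ∀ i, Measure (E i)) [∀ i, IsProbabilityMeasure (μ i)]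
    [∀ i, IsProbabilityMeasure (ν i)]
    {f : ∀ i, E i → ENNReal} (hf : ∀ i, Measurable (f i))
    (hν : ∀ i, ν i = (μ i).withDensity (f i)) :
    Measure.pi ν = (Measure.pi μ).withDensity fun x => ∏ i, f i (x i) := by
  apply Measure.pi_eq
  intro s hs
  rw [withDensity_apply _ (MeasurableSet.univ_pi hs),
    ← lintegral_indicator (MeasurableSet.univ_pi hs)]
  have : ∀ x, (Set.univ.pi s).indicator (fun x => ∏ i, f i (x i)) x =
      ∏ i, (s i).indicator (f i) (x i) := by
    intro x
    by_cases h : x ∈ Set.univ.pi s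
    · rw [Set.indicator_of_mem h]
      exact Finset.prod_congr rfl fun i _ =>
        (Set.indicator_of_mem (h i (Set.mem_univ i)) _).symm
    · rw [Set.indicator_of_notMem h]
      simp only [Set.mem_univ_pi, not_forall] at h
      obtain ⟨i, hi⟩ := h
      exact (Finset.prod_eq_zero (Finset.mem_univ i) (Set.indicator_of_notMem hi _)).symm
  rw [lintegral_congr this, lintegral_pi_prod μ fun i => (hf i).indicator (hs i)]
  refine Finset.prod_congr rfl fun i _ => ?_
  rw [lintegral_indicator (hs i), hν i, withDensity_apply _ (hs i)]

/-- The measure of an event under a density `f` in terms of the second moment of `f`. -/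
theorem withDensity_apply_le_of_sq {α : Type*} [MeasurableSpace α] (μ : Measure α)
    {f : α → ENNReal} (hf : Measurable f) {χ a : ℝ} (ha : 0 < a)
    (h2 : ∫⁻ x, f x ^ 2 ∂μ ≤ ENNReal.ofReal χ) {s : Set α} (hs : MeasurableSet s) :
    μ.withDensity f s ≤ ENNReal.ofReal (χ / (4 * a)) + ENNReal.ofReal a * μ s := by
  -- This is `(f - 2a)² ≥ 0`; the free parameter `a` plays the role of Cauchy–Schwarz.
  have hpt : ∀ x, f x ≤ ENNReal.ofReal (1 / (4 * a)) * f x ^ 2 + ENNReal.ofReal a := by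
    intro x
    rcases eq_or_ne (f x) ⊤ with h | h
    · have h1 : ENNReal.ofReal (1 / (4 * a)) ≠ 0 := by
        rw [ne_eq, ENNReal.ofReal_eq_zero, not_le]; positivity
      rw [h, ENNReal.top_pow two_ne_zero, ENNReal.mul_top h1, top_add]
    · lift f x to NNReal using h with y
      have hy : (y : ENNReal) = ENNReal.ofReal y := by simp
      rw [hy, ← ENNReal.ofReal_pow y.coe_nonneg, ← ENNReal.ofReal_mul (by positivity),
        ← ENNReal.ofReal_add (by positivity) ha.le]
      apply ENNReal.ofReal_le_ofReal
      have : (1 / (4 * a)) * (y : ℝ) ^ 2 + a - y = (y - 2 * a) ^ 2 / (4 * a) := by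
        field_simp; ring
      have h4 : 0 ≤ ((y : ℝ) - 2 * a) ^ 2 / (4 * a) := by positivity
      linarith
  rw [withDensity_apply _ hs]
  calc ∫⁻ x in s, f x ∂μ
      ≤ ∫⁻ x in s, (ENNReal.ofReal (1 / (4 * a)) * f x ^ 2 + ENNReal.ofReal a) ∂μ :=
        lintegral_mono fun x => hpt x
    _ = ENNReal.ofReal (1 / (4 * a)) * ∫⁻ x in s, f x ^ 2 ∂μ + ENNReal.ofReal a * μ s := by
        rw [lintegral_add_right _ measurable_const, lintegral_const_mul _ (hf.pow_const 2)]
        simp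
    _ ≤ ENNReal.ofReal (1 / (4 * a)) * ENNReal.ofReal χ + ENNReal.ofReal a * μ s := by
        gcongr
        exact (setLIntegral_le_lintegral s _).trans h2
    _ = _ := by
        rw [← ENNReal.ofReal_mul (by positivity)]
        congr 2
        ring

/-- The standard Gaussian measure on `ι → ℝ`. -/
noncomputable def gaussianPi (ι : Type*) [Fintype ι] : Measure (ι → ℝ) :=
  Measure.pi fun _ => ProbabilityTheory.gaussianReal 0 1

instance (ι : Type*) [Fintype ι] : IsProbabilityMeasure (gaussianPi ι) := by
  unfold gaussianPi; infer_instance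

/-- Multiplication of the coordinates in `I` by `√v`. -/
noncomputable def scaleOn {ι : Type*} [DecidableEq ι] (I : Finset ι) (v : ℝ) (x : ι → ℝ) : ι → ℝ :=
  fun i => (if i ∈ I then √v else 1) * x i

theorem measurable_scaleOn {ι : Type*} [DecidableEq ι] (I : Finset ι) (v : ℝ) :
    Measurable (scaleOn I v) := by
  unfold scaleOn; fun_prop

-- The rescaled vector has independent coordinates, of variance `v` on `I`, so its density
-- factorizes and each coordinate in `I` contributes one factor to the second moment.
open ProbabilityTheory in
theorem gaussianPi_preimage_scaleOn_le {ι : Type*} [Fintype ι] [DecidableEq ι] (I : Finset ι)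
    {v a : ℝ} (hv : 0 < v) (hv2 : v < 2) (ha : 0 < a) {s : Set (ι → ℝ)} (hs : MeasurableSet s) :
    gaussianPi ι (scaleOn I v ⁻¹' s) ≤
      ENNReal.ofReal ((√(v * (2 - v)))⁻¹ ^ I.card / (4 * a)) +
        ENNReal.ofReal a * gaussianPi ι s := by
  rw [← Measure.map_apply (measurable_scaleOn I v) hs]
  let V : NNReal := ⟨v, hv.le⟩
  have hV : V ≠ 0 := by
    intro h
    exact hv.ne' (congrArg NNReal.toReal h)
  let ν : ι → Measure ℝ := fun i => if i ∈ I then gaussianReal 0 V else gaussianReal 0 1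
  have hνp : ∀ i, IsProbabilityMeasure (ν i) := by
    intro i; simp only [ν]; split_ifs <;> infer_instance
  let f : ι → ℝ → ENNReal :=
    fun i => if i ∈ I then fun x => ENNReal.ofReal (gaussianRatio v x) else fun _ => 1
  have hf : ∀ i, Measurable (f i) := by
    intro i; simp only [f]; split_ifs
    · exact (measurable_gaussianRatio v).ennreal_ofReal
    · exact measurable_const
  have hmap : (gaussianPi ι).map (scaleOn I v) = Measure.pi ν := by
    have h1 : ∀ i, (gaussianReal 0 1).map (fun x => (if i ∈ I then √v else 1) * x) = ν i := by
      intro i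
      rw [gaussianReal_map_const_mul]
      simp only [ν]
      split_ifs
      · rw [mul_zero, mul_one]
        congr 1
        ext
        exact Real.sq_sqrt hv.le
      · simp
    have : ∀ i, SigmaFinite ((gaussianReal 0 1).map
        (fun x => (if i ∈ I then √v else 1) * x)) := by
      intro i; rw [h1]; infer_instance
    have h2 := Measure.pi_map_pi (μ := fun _ : ι => gaussianReal 0 1)
      (f := fun i x => (if i ∈ I then √v else 1) * x) (fun i => by fun_prop)
    simp only [h1] at h2
    exact h2
  rw [hmap, Measure.pi_withDensity_prod (fun _ => gaussianReal 0 1) ν hf]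
  · refine withDensity_apply_le_of_sq (f := fun x : ι → ℝ => ∏ i, f i (x i)) _
      (Finset.measurable_fun_prod _ fun i _ => (hf i).comp (measurable_pi_apply i)) ha ?_ hs
    simp_rw [← Finset.prod_pow]
    rw [lintegral_pi_prod (fun _ => gaussianReal 0 1) fun i => (hf i).pow_const 2]
    have h3 : ∀ i, ∫⁻ x, f i x ^ 2 ∂(gaussianReal 0 1) =
        if i ∈ I then ENNReal.ofReal (√(v * (2 - v)))⁻¹ else 1 := by
      intro i
      simp only [f]
      split_ifs
      · exact lintegral_gaussianRatio_sq hv hv2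
      · simp
    simp_rw [h3]
    rw [Finset.prod_ite_mem, Finset.univ_inter, Finset.prod_const,
      ENNReal.ofReal_pow (by positivity)]
  · intro i
    simp only [ν, f]
    split_ifs
    · exact gaussianReal_eq_withDensity_ratio hV
    · exact (withDensity_one).symm

/-! ### Rayleigh quotients of Gaussian vectors -/

theorem map_piCongrLeft_gaussianPi {ι : Type*} [Fintype ι] (e : Equiv.Perm ι) :
    (gaussianPi ι).map (fun x => x ∘ e) = gaussianPi ι := by
  have h := (measurePreserving_piCongrLeft
    (fun _ : ι => ProbabilityTheory.gaussianReal 0 1) e.symm).map_eq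
  have h2 : ⇑(MeasurableEquiv.piCongrLeft (fun _ : ι => ℝ) e.symm) = fun x => x ∘ e := by
    ext x i
    have := Equiv.piCongrLeft_apply_apply (P := fun _ : ι => ℝ) e.symm x (e i)
    simpa [MeasurableEquiv.coe_piCongrLeft] using this
  rw [h2] at h
  exact h

theorem lintegral_sq_div_eq {ι : Type*} [Fintype ι] [DecidableEq ι] (i j : ι) :
    ∫⁻ x, ENNReal.ofReal (x i ^ 2 / ∑ k, x k ^ 2) ∂(gaussianPi ι) =
      ∫⁻ x, ENNReal.ofReal (x j ^ 2 / ∑ k, x k ^ 2) ∂(gaussianPi ι) := by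
  conv_lhs => rw [← map_piCongrLeft_gaussianPi (Equiv.swap i j)]
  rw [lintegral_map (by fun_prop) (by fun_prop)]
  refine lintegral_congr fun x => ?_
  simp only [Function.comp_apply, Equiv.swap_apply_left]
  rw [Equiv.sum_comp (Equiv.swap i j) fun k => x k ^ 2]

/-- By exchangeability all coordinates have the same mean share of `‖x‖²`, and the shares sum to at
most 1 (to 0 at the origin, where `0 / 0 = 0`). -/
theorem lintegral_sq_div_le {ι : Type*} [Fintype ι] [DecidableEq ι] (i : ι) :
    ∫⁻ x, ENNReal.ofReal (x i ^ 2 / ∑ k, x k ^ 2) ∂(gaussianPi ι) ≤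
      ENNReal.ofReal (1 / Fintype.card ι) := by
  have hc : (0 : ℝ) < Fintype.card ι := by exact_mod_cast Fintype.card_pos_iff.2 ⟨i⟩
  have hsum : ∑ j, ∫⁻ x, ENNReal.ofReal (x j ^ 2 / ∑ k, x k ^ 2) ∂(gaussianPi ι) ≤ 1 := by
    rw [← lintegral_finsetSum _ fun j _ => by fun_prop]
    calc _ ≤ ∫⁻ _, 1 ∂(gaussianPi ι) := by
          refine lintegral_mono fun x => ?_
          rw [← ENNReal.ofReal_sum_of_nonneg fun j _ => by positivity, ← Finset.sum_div]
          exact ENNReal.ofReal_le_one.2 (div_self_le_one _)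
      _ = 1 := by simp
  rw [Finset.sum_congr rfl fun j _ => lintegral_sq_div_eq j i, Finset.sum_const,
    Finset.card_univ, nsmul_eq_mul, mul_comm] at hsum
  rw [one_div, ENNReal.ofReal_inv_of_pos hc, ENNReal.ofReal_natCast, ← one_div]
  exact ENNReal.le_div_iff_mul_le (Or.inl (by exact_mod_cast hc.ne'))
    (Or.inl (ENNReal.natCast_ne_top _)) |>.2 hsum

/-- Markov's inequality for the Rayleigh quotient of a diagonal quadratic form. -/
theorem gaussianPi_rayleigh_gt_le {ι : Type*} [Fintype ι] [DecidableEq ι] (w : ι → ℝ)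
    (hw : ∀ i, 0 ≤ w i) {θ : ℝ} (hθ : 0 < θ) :
    gaussianPi ι {x | θ * ∑ i, x i ^ 2 < ∑ i, w i * x i ^ 2} ≤
      ENNReal.ofReal ((∑ i, w i) / (θ * Fintype.card ι)) := by
  have hint : ∫⁻ x, ENNReal.ofReal ((∑ i, w i * x i ^ 2) / ∑ i, x i ^ 2) ∂(gaussianPi ι) ≤
      ENNReal.ofReal ((∑ i, w i) / Fintype.card ι) := by
    calc _ = ∫⁻ x, ∑ i, ENNReal.ofReal (w i) * ENNReal.ofReal (x i ^ 2 / ∑ k, x k ^ 2)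
          ∂(gaussianPi ι) := by
          refine lintegral_congr fun x => ?_
          rw [Finset.sum_div, ENNReal.ofReal_sum_of_nonneg fun i _ => by
            have := hw i
            positivity]
          refine Finset.sum_congr rfl fun i _ => ?_
          rw [← ENNReal.ofReal_mul (hw i), mul_div_assoc]
      _ = ∑ i, ENNReal.ofReal (w i) *
            ∫⁻ x, ENNReal.ofReal (x i ^ 2 / ∑ k, x k ^ 2) ∂(gaussianPi ι) := by
          rw [lintegral_finsetSum _ fun j _ => by fun_prop]
          exact Finset.sum_congr rfl fun i _ => lintegral_const_mul _ (by fun_prop)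
      _ ≤ ∑ i, ENNReal.ofReal (w i) * ENNReal.ofReal (1 / Fintype.card ι) := by
          gcongr with i _
          exact lintegral_sq_div_le i
      _ = _ := by
          rw [← Finset.sum_mul, ← ENNReal.ofReal_sum_of_nonneg fun i _ => hw i,
            ← ENNReal.ofReal_mul (Finset.sum_nonneg fun i _ => hw i), mul_one_div]
  have hsub : {x : ι → ℝ | θ * ∑ i, x i ^ 2 < ∑ i, w i * x i ^ 2} ⊆
      {x | ENNReal.ofReal θ ≤ ENNReal.ofReal ((∑ i, w i * x i ^ 2) / ∑ i, x i ^ 2)} := by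
    intro x hx
    simp only [Set.mem_ofPred_eq] at hx ⊢
    apply ENNReal.ofReal_le_ofReal
    have hN : 0 < ∑ i, x i ^ 2 := by
      refine (Finset.sum_nonneg fun i _ => sq_nonneg (x i)).lt_of_ne fun h => ?_
      have h0 : ∀ i, x i ^ 2 = 0 := fun i =>
        (Finset.sum_eq_zero_iff_of_nonneg fun i _ => sq_nonneg (x i)).1 h.symm i
          (Finset.mem_univ i)
      simp [h0] at hx
    rw [le_div_iff₀ hN]
    exact hx.le
  refine (measure_mono hsub).trans ((meas_ge_le_lintegral_div (by fun_prop)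
    (by simpa using hθ) ENNReal.ofReal_ne_top).trans ?_)
  calc _ ≤ ENNReal.ofReal ((∑ i, w i) / Fintype.card ι) / ENNReal.ofReal θ := by gcongr
    _ = _ := by
      rw [← ENNReal.ofReal_div_of_pos hθ, div_div, mul_comm]

/-! ### Distortion of diagonal quadratic forms -/

/-- The vectors on which the diagonal quadratic form with coefficients `w` distorts the squared
Euclidean norm by more than a factor `1 ± ε`. -/
def distortedSet {ι : Type*} [Fintype ι] (w : ι → ℝ) (ε : ℝ) : Set (ι → ℝ) :=
  {x | ∑ i, w i * x i ^ 2 ∉ Set.Icc ((1 - ε) * ∑ i, x i ^ 2) ((1 + ε) * ∑ i, x i ^ 2)}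

theorem measurableSet_distortedSet {ι : Type*} [Fintype ι] (w : ι → ℝ) (ε : ℝ) :
    MeasurableSet (distortedSet w ε) := by
  have h1 : Measurable fun x : ι → ℝ => ∑ i, w i * x i ^ 2 := by fun_prop
  have h2 : Measurable fun x : ι → ℝ => (1 - ε) * ∑ i, x i ^ 2 := by fun_prop
  have h3 : Measurable fun x : ι → ℝ => (1 + ε) * ∑ i, x i ^ 2 := by fun_prop
  exact ((measurableSet_le h2 h1).inter (measurableSet_le h1 h3)).compl

theorem sum_scaleOn_sq {ι : Type*} [Fintype ι] [DecidableEq ι] (I : Finset ι) {v : ℝ} (hv : 0 ≤ v)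
    (w x : ι → ℝ) :
    ∑ i, w i * scaleOn I v x i ^ 2 = v * ∑ i, w i * x i ^ 2 +
      (1 - v) * ∑ i, (if i ∈ I then 0 else w i) * x i ^ 2 := by
  rw [Finset.mul_sum, Finset.mul_sum, ← Finset.sum_add_distrib]
  refine Finset.sum_congr rfl fun i _ => ?_
  simp only [scaleOn, mul_pow]
  split_ifs
  · rw [Real.sq_sqrt hv]; ring
  · ring

/-- With `N = ‖x‖²`, the new form is at most `(1 - 3.8ε)(1 + ε)N + 3.8ε · 0.45N ≤ (1 - 1.09ε)N`,
whereas the new lower limit is at least `(1 - ε)(1 - 0.076ε)N ≥ (1 - 1.076ε)N`. -/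
theorem scaleOn_mem_distortedSet {ι : Type*} [Fintype ι] [DecidableEq ι] {w : ι → ℝ}
    {I : Finset ι} {ε : ℝ} (hε : 0 < ε) (hε4 : ε ≤ 1 / 4) {x : ι → ℝ}
    (hN : 0 < ∑ i, x i ^ 2)
    (hR : ∑ i, (if i ∈ I then 0 else w i) * x i ^ 2 ≤ 9 / 20 * ∑ i, x i ^ 2)
    (hI : ∑ i, (if i ∈ I then 1 else 0) * x i ^ 2 ≤ 1 / 50 * ∑ i, x i ^ 2)
    (hx : x ∉ distortedSet w ε) : scaleOn I (1 - 19 / 5 * ε) x ∈ distortedSet w ε := by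
  have hv : 0 ≤ 1 - 19 / 5 * ε := by linarith
  have hw := sum_scaleOn_sq I hv w x
  have h1 := sum_scaleOn_sq I hv (fun _ => 1) x
  simp only [one_mul] at h1
  have hsplit : ∑ i, (if i ∈ I then (1 : ℝ) else 0) * x i ^ 2 +
      ∑ i, (if i ∈ I then (0 : ℝ) else 1) * x i ^ 2 = ∑ i, x i ^ 2 := by
    rw [← Finset.sum_add_distrib]
    refine Finset.sum_congr rfl fun i _ => ?_
    split_ifs <;> ring
  simp only [distortedSet, Set.mem_ofPred_eq, not_not] at hx ⊢
  intro h
  have hx2 := hx.2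
  have hlow := h.1
  rw [hw, h1] at hlow
  generalize ∑ i, (if i ∈ I then 0 else w i) * x i ^ 2 = R at *
  generalize ∑ i, (if i ∈ I then (1 : ℝ) else 0) * x i ^ 2 = N₁ at *
  generalize ∑ i, (if i ∈ I then (0 : ℝ) else 1) * x i ^ 2 = N₂ at *
  generalize ∑ i, w i * x i ^ 2 = W at *
  generalize ∑ i, x i ^ 2 = N at *
  obtain rfl : N₂ = N - N₁ := by linarith
  have a1 := mul_le_mul_of_nonneg_left hx2 hv
  have a2 := mul_le_mul_of_nonneg_left hR hε.le
  have a3 := mul_le_mul_of_nonneg_left hI hε.le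
  have a4 := mul_le_mul_of_nonneg_left hI (mul_nonneg hε.le hε.le)
  have a5 : 0 < ε * N := mul_pos hε hN
  have a6 : 0 ≤ ε * (ε * N) := by positivity
  nlinarith

/-- Every nonzero `x` is atypical, distorted, or distorted after shrinking. The two atypical events
cost `20/27 + 1/20 < 4/5` by Markov. -/
theorem one_le_gaussianPi_distortedSet {ι : Type*} [Fintype ι] [DecidableEq ι] [Nonempty ι]
    {w : ι → ℝ} (hw : ∀ i, 0 ≤ w i) {I : Finset ι} {ε a : ℝ} (hε : 0 < ε) (hε4 : ε ≤ 1 / 4)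
    (ha : 0 < a)
    (hR : ∑ i, (if i ∈ I then 0 else w i) ≤ Fintype.card ι / 3)
    (hI : (I.card : ℝ) ≤ Fintype.card ι / 1000) :
    1 ≤ 4 / 5 + (√(1 - (19 / 5 * ε) ^ 2))⁻¹ ^ I.card / (4 * a) +
      (1 + a) * (gaussianPi ι).real (distortedSet w ε) := by
  have hc : (0 : ℝ) < Fintype.card ι := by exact_mod_cast Fintype.card_pos
  have hcover : Set.univ ⊆ {x : ι → ℝ | 9 / 20 * ∑ i, x i ^ 2 <
        ∑ i, (if i ∈ I then 0 else w i) * x i ^ 2} ∪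
      {x : ι → ℝ | 1 / 50 * ∑ i, x i ^ 2 < ∑ i, (if i ∈ I then 1 else 0) * x i ^ 2} ∪ {0} ∪
      distortedSet w ε ∪ scaleOn I (1 - 19 / 5 * ε) ⁻¹' distortedSet w ε := by
    intro x _
    by_contra h
    simp only [Set.mem_union, Set.mem_ofPred_eq, not_or, not_lt, Set.mem_singleton_iff,
      Set.mem_preimage] at h
    obtain ⟨⟨⟨⟨h1, h2⟩, h3⟩, h4⟩, h5⟩ := h
    refine h5 (scaleOn_mem_distortedSet hε hε4 ?_ h1 h2 h4)
    refine (Finset.sum_nonneg fun i _ => sq_nonneg (x i)).lt_of_ne fun h => h3 ?_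
    ext i
    simpa using (Finset.sum_eq_zero_iff_of_nonneg fun i _ => sq_nonneg (x i)).1 h.symm i
      (Finset.mem_univ i)
  have hzero : gaussianPi ι {0} = 0 := by
    have := ProbabilityTheory.nullSingletonClass_gaussianReal (μ := 0) (v := 1) one_ne_zero
    unfold gaussianPi
    exact measure_singleton _
  have e1 := gaussianPi_rayleigh_gt_le (fun i => if i ∈ I then 0 else w i)
    (fun i => by split_ifs; exacts [le_rfl, hw i]) (θ := 9 / 20) (by norm_num)
  have e2 := gaussianPi_rayleigh_gt_le (fun i => if i ∈ I then (1 : ℝ) else 0)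
    (fun i => by split_ifs <;> norm_num) (θ := 1 / 50) (by norm_num)
  have e3 := gaussianPi_preimage_scaleOn_le I (v := 1 - 19 / 5 * ε) (by linarith) (by linarith) ha
    (measurableSet_distortedSet w ε)
  rw [show (1 - 19 / 5 * ε) * (2 - (1 - 19 / 5 * ε)) = 1 - (19 / 5 * ε) ^ 2 by ring] at e3
  set χ := (√(1 - (19 / 5 * ε) ^ 2))⁻¹ ^ I.card
  have hχ : 0 ≤ χ / (4 * a) := by positivity
  have hp : gaussianPi ι (distortedSet w ε) =
      ENNReal.ofReal ((gaussianPi ι).real (distortedSet w ε)) := by simp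
  have f1 : (∑ i, if i ∈ I then 0 else w i) / (9 / 20 * Fintype.card ι) ≤ 20 / 27 := by
    rw [div_le_iff₀ (by positivity)]; linarith
  have f2 : (∑ i, if i ∈ I then (1 : ℝ) else 0) / (1 / 50 * Fintype.card ι) ≤ 1 / 20 := by
    rw [div_le_iff₀ (by positivity), Finset.sum_ite_mem, Finset.univ_inter]
    simp only [Finset.sum_const, nsmul_eq_mul, mul_one]
    linarith
  have hp0 : 0 ≤ (gaussianPi ι).real (distortedSet w ε) := measureReal_nonneg
  rw [← ENNReal.ofReal_le_ofReal_iff (by positivity), ENNReal.ofReal_one]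
  calc (1 : ENNReal) = gaussianPi ι Set.univ := measure_univ.symm
    _ ≤ ENNReal.ofReal (20 / 27) + ENNReal.ofReal (1 / 20) + 0 +
        gaussianPi ι (distortedSet w ε) +
        (ENNReal.ofReal (χ / (4 * a)) + ENNReal.ofReal a * gaussianPi ι (distortedSet w ε)) := by
        refine (measure_mono hcover).trans ((measure_union_le _ _).trans (add_le_add ?_ e3))
        refine (measure_union_le _ _).trans (add_le_add ?_ le_rfl)
        refine (measure_union_le _ _).trans (add_le_add ?_ hzero.le)
        refine (measure_union_le _ _).trans (add_le_add
          (e1.trans (ENNReal.ofReal_le_ofReal f1)) (e2.trans (ENNReal.ofReal_le_ofReal f2)))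
    _ ≤ _ := by
        rw [hp, add_zero, ← ENNReal.ofReal_mul ha.le, ← ENNReal.ofReal_add (by positivity)
          (by positivity), ← ENNReal.ofReal_add (by positivity) (by positivity),
          ← ENNReal.ofReal_add (by positivity) (by positivity),
          ← ENNReal.ofReal_add (by positivity) (by positivity)]
        apply ENNReal.ofReal_le_ofReal
        linarith

theorem inv_sqrt_pow_le {ε δ : ℝ} (n : ℕ) (hε : 0 < ε) (hε4 : ε ≤ 1 / 4) (hδ : 0 < δ)
    (hn : n * ε ^ 2 ≤ 1 / 1000 * Real.log (1 / δ)) :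
    (√(1 - (19 / 5 * ε) ^ 2))⁻¹ ^ n ≤ (√δ)⁻¹ := by
  -- The value at `ε = 1/4`; it gives the constant below through `(19/5)² · 400/39 < 150`.
  have hu : 39 / 400 ≤ 1 - (19 / 5 * ε) ^ 2 := by nlinarith
  have hu0 : 0 < 1 - (19 / 5 * ε) ^ 2 := by linarith
  rw [← Real.log_le_log_iff (by positivity) (by positivity), Real.log_pow, Real.log_inv,
    Real.log_inv, Real.log_sqrt hu0.le, Real.log_sqrt hδ.le]
  rw [one_div δ, Real.log_inv] at hn
  have h1 := Real.one_sub_inv_le_log_of_pos hu0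
  have h2 : (1 - (19 / 5 * ε) ^ 2)⁻¹ - 1 ≤ 150 * ε ^ 2 := by
    rw [sub_le_iff_le_add, inv_le_comm₀ hu0 (by positivity), ← one_div,
      div_le_iff₀ (by positivity)]
    nlinarith [sq_nonneg ε, mul_nonneg (sq_nonneg ε) (sub_nonneg.2 hu)]
  have h3 : -Real.log (1 - (19 / 5 * ε) ^ 2) ≤ 150 * ε ^ 2 := by linarith
  have h4 := mul_le_mul_of_nonneg_left h3 (Nat.cast_nonneg (α := ℝ) n)
  have h5 : 0 ≤ (n : ℝ) * ε ^ 2 := by positivity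
  linarith

theorem two_mul_le_gaussianPi_distortedSet {ι : Type*} [Fintype ι] [DecidableEq ι] [Nonempty ι]
    {w : ι → ℝ} (hw : ∀ i, 0 ≤ w i) {I : Finset ι} {ε δ : ℝ} (hε : 0 < ε) (hε4 : ε ≤ 1 / 4)
    (hδ : 0 < δ) (hδC : δ ≤ 1 / 5000)
    (hR : ∑ i, (if i ∈ I then 0 else w i) ≤ Fintype.card ι / 3)
    (hI : (I.card : ℝ) ≤ Fintype.card ι / 1000)
    (hn : I.card * ε ^ 2 ≤ 1 / 1000 * Real.log (1 / δ)) :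
    2 * δ ≤ (gaussianPi ι).real (distortedSet w ε) := by
  have hr : 0 < √δ := Real.sqrt_pos.2 hδ
  -- This `a` makes the second-moment term at most `1/10`, leaving `1/10 ≤ (1 + a) p`.
  have h := one_le_gaussianPi_distortedSet hw hε hε4 (a := 5 / 2 * (√δ)⁻¹) (by positivity) hR hI
  have hχ := inv_sqrt_pow_le I.card hε hε4 hδ hn
  have h1 : (√(1 - (19 / 5 * ε) ^ 2))⁻¹ ^ I.card / (4 * (5 / 2 * (√δ)⁻¹)) ≤ 1 / 10 := by
    rw [div_le_iff₀ (by positivity)]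
    linarith
  generalize (gaussianPi ι).real (distortedSet w ε) = p at *
  have h2 : 1 / 10 ≤ (1 + 5 / 2 * (√δ)⁻¹) * p := by linarith
  have h3 : √δ * (1 / 10) ≤ (√δ + 5 / 2) * p := by
    have := mul_le_mul_of_nonneg_left h2 hr.le
    rwa [← mul_assoc, mul_add, mul_one, mul_left_comm, mul_inv_cancel₀ hr.ne', mul_one] at this
  have h4 : √δ * √δ = δ := Real.mul_self_sqrt hδ.le
  have h5 : √δ ≤ 1 / 70 := by
    rw [Real.sqrt_le_left (by norm_num)]
    norm_num
    linarith
  nlinarith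

/-! ### Spectrum of the Gram matrix -/

open scoped RealInnerProductSpace in
theorem norm_sq_toEuclideanLin_eq_sum {m d : ℕ} (B : Matrix (Fin m) (Fin d) ℝ)
    (x : EuclideanSpace ℝ (Fin d)) :
    ‖Matrix.toEuclideanLin B x‖ ^ 2 =
      ∑ i, (isHermitian_gram B).eigenvalues i *
        ((isHermitian_gram B).eigenvectorBasis.repr x i) ^ 2 := by
  set H := isHermitian_gram B
  have hT : ∀ y, Matrix.toEuclideanLin (B.transpose * B) y =
      LinearMap.adjoint (Matrix.toEuclideanLin B) (Matrix.toEuclideanLin B y) := by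
    intro y
    rw [← Matrix.toEuclideanLin_conjTranspose_eq_adjoint,
      Matrix.conjTranspose_eq_transpose_of_trivial]
    ext i
    simp [Matrix.toLpLin_apply, Matrix.mulVec_mulVec]
  have hb : ∀ i, Matrix.toEuclideanLin (B.transpose * B) (H.eigenvectorBasis i) =
      H.eigenvalues i • H.eigenvectorBasis i := by
    intro i
    ext j
    simpa [Matrix.toLpLin_apply] using congrFun (H.mulVec_eigenvectorBasis i) j
  have hsymm := Matrix.isSymmetric_toEuclideanLin_iff.2 H
  rw [← real_inner_self_eq_norm_sq, ← LinearMap.adjoint_inner_right, ← hT,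
    ← H.eigenvectorBasis.sum_inner_mul_inner]
  refine Finset.sum_congr rfl fun i _ => ?_
  rw [← hsymm, hb, inner_smul_left, OrthonormalBasis.repr_apply_apply, real_inner_comm]
  simp only [conj_trivial]
  ring

theorem eigenvalues_gram_nonneg {m d : ℕ} (B : Matrix (Fin m) (Fin d) ℝ) (i : Fin d) :
    0 ≤ (isHermitian_gram B).eigenvalues i := by
  have h := norm_sq_toEuclideanLin_eq_sum B ((isHermitian_gram B).eigenvectorBasis i)
  rw [Finset.sum_eq_single i] at h
  · simp only [OrthonormalBasis.repr_self, PiLp.single_apply, if_true, one_pow, mul_one] at h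
    rw [← h]
    positivity
  · intro j _ hj
    simp [OrthonormalBasis.repr_self, hj]
  · simp

theorem card_eigenvalues_gram_ne_zero_le {m d : ℕ} (B : Matrix (Fin m) (Fin d) ℝ) :
    (Finset.univ.filter fun i => (isHermitian_gram B).eigenvalues i ≠ 0).card ≤ m := by
  have h := (isHermitian_gram B).rank_eq_card_non_zero_eigs
  rw [Fintype.card_subtype] at h
  rw [← h]
  calc _ ≤ B.transpose.rank := Matrix.rank_mul_le_left _ _
    _ ≤ m := by
      rw [Matrix.rank_transpose]
      simpa using B.rank_le_card_height

theorem card_eigenvalues_gram_ge_lt {m d : ℕ} (B : Matrix (Fin m) (Fin d) ℝ) {k : ℕ} {τ : ℝ}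
    (hk : 1 ≤ k) (hkd : k ≤ d) (h : gramEigenvalue B k < τ) :
    (Finset.univ.filter fun i => τ ≤ (isHermitian_gram B).eigenvalues i).card ≤ k - 1 := by
  rw [gramEigenvalue, dif_pos ⟨hk, hkd⟩] at h
  set H := isHermitian_gram B
  -- The reindexing by which `eigenvalues` is defined from the sorted `eigenvalues₀`.
  let e : Fin d ≃ Fin (Fintype.card (Fin d)) := (Fintype.equivOfCardEq (Fintype.card_fin _)).symm
  calc _ ≤ (Finset.range (k - 1)).card := by
        refine Finset.card_le_card_of_injOn (fun i => (e i : ℕ)) ?_ ?_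
        · intro i hi
          simp only [Finset.coe_filter, Finset.mem_univ, true_and, Set.mem_ofPred_eq] at hi
          simp only [Finset.coe_range, Set.mem_Iio]
          by_contra hlt
          refine absurd (hi.trans ?_) (not_le.2 h)
          exact H.eigenvalues₀_antitone (Fin.mk_le_of_le_val (not_lt.1 hlt))
        · intro i _ j _ hij
          exact e.injective (Fin.ext hij)
    _ = k - 1 := Finset.card_range _

/-! ### Gaussian failure probability of a fixed matrix -/

/-- The vectors whose squared norm is distorted by `s ^ (-1/2) B` by more than a factor
`1 ± ε`. -/
def jlFailure {m d : ℕ} (B : Matrix (Fin m) (Fin d) ℝ) (ε : ℝ) (s : ℕ) :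
    Set (EuclideanSpace ℝ (Fin d)) :=
  {x | ‖(√(s : ℝ))⁻¹ • Matrix.toEuclideanLin B x‖ ^ 2 ∉
      Set.Icc ((1 - ε) * ‖x‖ ^ 2) ((1 + ε) * ‖x‖ ^ 2)}

/-- The standard Gaussian is rotation invariant, so its coordinates in the eigenbasis are again
independent standard normals. -/
theorem stdGaussian_jlFailure {m d : ℕ} (B : Matrix (Fin m) (Fin d) ℝ) (ε : ℝ) (s : ℕ) :
    ProbabilityTheory.stdGaussian (EuclideanSpace ℝ (Fin d)) (jlFailure B ε s) =
      gaussianPi (Fin d)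
        (distortedSet (fun i => (isHermitian_gram B).eigenvalues i / s) ε) := by
  set w : Fin d → ℝ := fun i => (isHermitian_gram B).eigenvalues i / s
  set b := (isHermitian_gram B).eigenvectorBasis
  have hset : jlFailure B ε s =
      b.repr ⁻¹' ((WithLp.ofLp : EuclideanSpace ℝ (Fin d) → _) ⁻¹' distortedSet w ε) := by
    ext x
    simp only [jlFailure, distortedSet, Set.mem_preimage, Set.mem_ofPred_eq]
    have h1 : ‖x‖ ^ 2 = ∑ i, b.repr x i ^ 2 := by
      rw [← b.repr.norm_map x, EuclideanSpace.real_norm_sq_eq]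
    have h2 : ‖(√(s : ℝ))⁻¹ • Matrix.toEuclideanLin B x‖ ^ 2 = ∑ i, w i * b.repr x i ^ 2 := by
      rw [norm_smul, mul_pow, norm_sq_toEuclideanLin_eq_sum, Real.norm_eq_abs, sq_abs, inv_pow,
        Real.sq_sqrt (Nat.cast_nonneg s), Finset.mul_sum]
      refine Finset.sum_congr rfl fun i _ => ?_
      simp only [w, b]
      ring
    rw [h1, h2]
  have hm : MeasurableSet ((WithLp.ofLp : EuclideanSpace ℝ (Fin d) → _) ⁻¹' distortedSet w ε) :=
    (PiLp.continuous_ofLp 2 _).measurable (measurableSet_distortedSet w ε)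
  rw [hset, ← Measure.map_apply b.repr.continuous.measurable hm,
    ProbabilityTheory.stdGaussian_map, ← ProbabilityTheory.map_pi_eq_stdGaussian,
    Measure.map_apply (PiLp.continuous_toLp 2 _).measurable hm]
  rfl

theorem two_mul_le_stdGaussian_jlFailure {m d s k : ℕ} {ε δ : ℝ} (B : Matrix (Fin m) (Fin d) ℝ)
    (hm : 0 < m) (hmd : m ≤ d) (hs : 0 < s) (hε : 0 < ε) (hε4 : ε ≤ 1 / 4)
    (hδ : 0 < δ) (hδC : δ ≤ 1 / 5000) (hk : 1 ≤ k)
    (hkm : ((k : ℝ) - 1) ≤ m / 1000)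
    (hn : ((k : ℝ) - 1) * ε ^ 2 ≤ 1 / 1000 * Real.log (1 / δ))
    (h : gramEigenvalue B k < d * s / (3 * m)) :
    ENNReal.ofReal (2 * δ) ≤
      ProbabilityTheory.stdGaussian (EuclideanSpace ℝ (Fin d)) (jlFailure B ε s) := by
  have : Nonempty (Fin d) := ⟨⟨0, by omega⟩⟩
  have hm' : (0 : ℝ) < m := by exact_mod_cast hm
  have hs' : (0 : ℝ) < s := by exact_mod_cast hs
  have hmd' : (m : ℝ) ≤ d := by exact_mod_cast hmd
  -- Keeps `gramEigenvalue B k` away from its default value `0`.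
  have hkd : k ≤ d := by
    have : (k : ℝ) < d + 1 := by linarith
    exact Nat.lt_succ_iff.1 (by exact_mod_cast this)
  have hcard := card_eigenvalues_gram_ge_lt B hk hkd h
  rw [stdGaussian_jlFailure]
  set lam := (isHermitian_gram B).eigenvalues
  set τ : ℝ := d * s / (3 * m)
  have hτ : 0 ≤ τ := by positivity
  set I := Finset.univ.filter fun i => τ ≤ lam i
  have hcard' : (I.card : ℝ) ≤ k - 1 := by
    have : ((k - 1 : ℕ) : ℝ) = k - 1 := by push_cast [hk]; ring
    rw [← this]
    exact_mod_cast hcard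
  have hlam := eigenvalues_gram_nonneg B
  refine (ENNReal.ofReal_le_ofReal (two_mul_le_gaussianPi_distortedSet (I := I) (w := fun i => lam i / s)
    (fun i => div_nonneg (hlam i) hs'.le) hε hε4 hδ hδC ?_ ?_ ?_)).trans_eq (by simp)
  · rw [Fintype.card_fin]
    -- Only the at most `m` nonzero eigenvalues count, each below `τ` off `I`; the `3m` in `τ` is
    -- chosen to give `d / 3`.
    calc ∑ i, (if i ∈ I then 0 else lam i / s)
        ≤ ∑ i, (if lam i ≠ 0 then τ / s else 0) := by
          refine Finset.sum_le_sum fun i _ => ?_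
          by_cases h0 : lam i = 0
          · simp [h0]
          · rw [if_pos h0]
            split_ifs with hi
            · positivity
            · have : lam i < τ := by simpa [I] using hi
              gcongr
      _ = (Finset.univ.filter fun i => lam i ≠ 0).card * (τ / s) := by
          rw [← Finset.sum_filter, Finset.sum_const, nsmul_eq_mul]
      _ ≤ m * (τ / s) := by
          gcongr
          exact card_eigenvalues_gram_ne_zero_le B
      _ = d / 3 := by
          simp only [τ]
          field_simp
  · rw [Fintype.card_fin]
    linarith
  · exact (mul_le_mul_of_nonneg_right hcard' (sq_nonneg ε)).trans hn

/-! ### Measurability and passage to a random matrix -/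

instance Matrix.instBorelSpaceReal {m d : ℕ} : BorelSpace (Matrix (Fin m) (Fin d) ℝ) :=
  inferInstanceAs (BorelSpace (Fin m → Fin d → ℝ))

instance Matrix.instSecondCountableTopologyReal {m d : ℕ} :
    SecondCountableTopology (Matrix (Fin m) (Fin d) ℝ) :=
  inferInstanceAs (SecondCountableTopology (Fin m → Fin d → ℝ))

theorem measurable_matrix_entry {m d : ℕ} (i : Fin m) (j : Fin d) :
    Measurable fun B : Matrix (Fin m) (Fin d) ℝ => B i j :=
  (measurable_pi_apply (X := fun _ : Fin d => ℝ) j).comp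
    (measurable_pi_apply (X := fun _ : Fin m => Fin d → ℝ) i)

theorem measurableSet_jlFailure_prod {m d : ℕ} (ε : ℝ) (s : ℕ) :
    MeasurableSet {p : Matrix (Fin m) (Fin d) ℝ × EuclideanSpace ℝ (Fin d) |
      p.2 ∈ jlFailure p.1 ε s} := by
  have h1 : Measurable fun p : Matrix (Fin m) (Fin d) ℝ × EuclideanSpace ℝ (Fin d) =>
      ‖(√(s : ℝ))⁻¹ • Matrix.toEuclideanLin p.1 p.2‖ ^ 2 := by
    have hcoord : ∀ j, Measurable fun x : EuclideanSpace ℝ (Fin d) => x j := fun j => by fun_prop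
    simp_rw [EuclideanSpace.real_norm_sq_eq, PiLp.smul_apply, smul_eq_mul, Matrix.toLpLin_apply, Matrix.mulVec,
      dotProduct]
    refine Finset.measurable_fun_sum _ fun i _ => Measurable.pow_const (Measurable.const_mul
      (Finset.measurable_fun_sum _ fun j _ => ?_) _) 2
    exact ((measurable_matrix_entry i j).comp measurable_fst).mul
      ((hcoord j).comp measurable_snd)
  have h2 : Measurable fun p : Matrix (Fin m) (Fin d) ℝ × EuclideanSpace ℝ (Fin d) =>
      (1 - ε) * ‖p.2‖ ^ 2 := by fun_prop
  have h3 : Measurable fun p : Matrix (Fin m) (Fin d) ℝ × EuclideanSpace ℝ (Fin d) =>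
      (1 + ε) * ‖p.2‖ ^ 2 := by fun_prop
  exact ((measurableSet_le h2 h1).inter (measurableSet_le h1 h3)).compl

/-- If every fixed vector fails with probability at most `δ`, then with probability at least `1/2`
the set of failing vectors has measure less than `2 δ`. -/
theorem half_le_measure_slice_lt {α β : Type*} [MeasurableSpace α] [MeasurableSpace β]
    (Q : Measure α) [IsProbabilityMeasure Q] (γ : Measure β) [IsProbabilityMeasure γ]
    {F : Set (α × β)} (hF : MeasurableSet F) {δ : ℝ} (hδ : 0 < δ)
    (h : ∀ x, Q {B | (B, x) ∈ F} ≤ ENNReal.ofReal δ) :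
    1 / 2 ≤ Q {B | γ {x | (B, x) ∈ F} < ENNReal.ofReal (2 * δ)} := by
  have hmeas : Measurable fun B => γ {x | (B, x) ∈ F} := measurable_measure_prodMk_left hF
  have hint : ∫⁻ B, γ {x | (B, x) ∈ F} ∂Q ≤ ENNReal.ofReal δ := by
    calc _ = (Q.prod γ) F := (Measure.prod_apply hF).symm
      _ = ∫⁻ x, Q {B | (B, x) ∈ F} ∂γ := Measure.prod_apply_symm hF
      _ ≤ ∫⁻ _, ENNReal.ofReal δ ∂γ := lintegral_mono h
      _ = ENNReal.ofReal δ := by simp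
  -- Markov's inequality: the mean slice measure is at most `δ`, half the threshold.
  have hbad : Q {B | ENNReal.ofReal (2 * δ) ≤ γ {x | (B, x) ∈ F}} ≤ 1 / 2 := by
    refine (meas_ge_le_lintegral_div hmeas.aemeasurable (by simpa using hδ)
      ENNReal.ofReal_ne_top).trans ?_
    calc _ ≤ ENNReal.ofReal δ / ENNReal.ofReal (2 * δ) := by gcongr
      _ = ENNReal.ofReal (1 / 2) := by
          rw [← ENNReal.ofReal_div_of_pos (by positivity)]
          congr 1
          field_simp
      _ = 1 / 2 := by rw [ENNReal.ofReal_div_of_pos (by norm_num)]; simp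
  have hcompl : {B | γ {x | (B, x) ∈ F} < ENNReal.ofReal (2 * δ)} =
      {B | ENNReal.ofReal (2 * δ) ≤ γ {x | (B, x) ∈ F}}ᶜ := by
    ext B
    simp
  rw [hcompl, prob_compl_eq_one_sub (measurableSet_le measurable_const hmeas)]
  calc (1 : ENNReal) / 2 = 1 - 1 / 2 := by simp
    _ ≤ _ := tsub_le_tsub_left hbad 1

/-! ### The main theorem -/

theorem lemma4 :
    ∃ C c : ℝ, 0 < C ∧ 0 < c ∧ c < 1 ∧
      ∀ (Ω : Type*) [MeasurableSpace Ω] (P : Measure Ω) [IsProbabilityMeasure P]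
        (m d s : ℕ) (ε δ t : ℝ) (A : Ω → Matrix (Fin m) (Fin d) ℝ),
        Measurable A → 0 < s → 0 < ε → ε ≤ 1 / 4 → 0 < δ → δ < 1 → δ ≤ C →
        1 ≤ t → t * ε⁻¹ ^ 2 * Real.log (1 / δ) = (m : ℝ) → m ≤ d →
        IsScaledJL P A ε δ s →
        ∃ S : Set (Matrix (Fin m) (Fin d) ℝ),
          MeasurableSet S ∧ S ⊆ (P.map A).support ∧ 1 / 2 ≤ P (A ⁻¹' S) ∧
          ∀ B ∈ S, (d : ℝ) * s / (3 * m) ≤ gramEigenvalue B ⌈c * m / t⌉₊ := by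
  refine ⟨1 / 5000, 1 / 1000, by norm_num, by norm_num, by norm_num, ?_⟩
  intro Ω _ P _ m d s ε δ t A hA hs hε hε4 hδ hδ1 hδC ht hm hmd hJL
  have hlog : 0 < Real.log (1 / δ) := Real.log_pos (by rw [lt_div_iff₀ hδ]; linarith)
  have ht0 : 0 < t := by linarith
  have hm0 : (0 : ℝ) < m := by rw [← hm]; positivity
  have hmn : 0 < m := by exact_mod_cast hm0
  set γ := ProbabilityTheory.stdGaussian (EuclideanSpace ℝ (Fin d))
  have hQ : IsProbabilityMeasure (P.map A) := Measure.isProbabilityMeasure_map hA.aemeasurable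
  have hF := measurableSet_jlFailure_prod (m := m) (d := d) ε s
  have hslice : ∀ x, (P.map A) {B | x ∈ jlFailure B ε s} ≤ ENNReal.ofReal δ := by
    intro x
    have hx : MeasurableSet {B : Matrix (Fin m) (Fin d) ℝ | x ∈ jlFailure B ε s} :=
      (measurable_prodMk_right (y := x)) hF
    rw [Measure.map_apply hA hx]
    have hle := (hJL x).le
    exact hle
  have hhalf := half_le_measure_slice_lt (P.map A) γ hF hδ hslice
  have hmeas : Measurable fun B : Matrix (Fin m) (Fin d) ℝ => γ (jlFailure B ε s) :=
    measurable_measure_prodMk_left hF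
  have hG : MeasurableSet {B : Matrix (Fin m) (Fin d) ℝ |
      γ (jlFailure B ε s) < ENNReal.ofReal (2 * δ)} := measurableSet_lt hmeas measurable_const
  have hsupp : MeasurableSet (P.map A).support := Measure.isClosed_support.measurableSet
  refine ⟨{B | γ (jlFailure B ε s) < ENNReal.ofReal (2 * δ)} ∩ (P.map A).support,
    hG.inter hsupp, Set.inter_subset_right, ?_, ?_⟩
  · rw [← Measure.map_apply hA (hG.inter hsupp),
      measure_inter_conull Measure.measure_compl_support]
    exact hhalf
  · rintro B ⟨hB, -⟩
    by_contra hlt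
    have hpos : 0 < 1 / 1000 * (m : ℝ) / t := by positivity
    -- Only `k - 1 < cm/t` is needed, since `I` has at most `k - 1` elements.
    have hk := Nat.ceil_lt_add_one hpos.le
    have hmt : (m : ℝ) / t * ε ^ 2 = Real.log (1 / δ) := by
      rw [← hm]
      field_simp
    refine absurd (two_mul_le_stdGaussian_jlFailure B hmn hmd hs hε hε4 hδ hδC
      (Nat.one_le_ceil_iff.2 hpos) ?_ ?_ (not_le.1 hlt)) (not_le.2 hB)
    · have : 1 / 1000 * (m : ℝ) / t ≤ 1 / 1000 * m := div_le_self (by positivity) ht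
      linarith
    · have : ((⌈1 / 1000 * (m : ℝ) / t⌉₊ : ℝ) - 1) * ε ^ 2 ≤ 1 / 1000 * (m : ℝ) / t * ε ^ 2 := by
        gcongr
        linarith
      rw [← hmt]
      calc _ ≤ _ := this
        _ = _ := by ring
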